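/- Let $J$ be a number of agents and let $(\Xi,\mathcal F,P)$ be a probability space (for example the one induced by a random vector $\xi$ in $\mathbb R^d$ with support $\Xi$). Let $c_j>0$ and $a_j>0$ for $j=1,\dots,J$, put $C=\operatorname{diag}(c_1,\dots,c_J)$ and $a=(a_1,\dots,a_J)^T$, and let $\gamma:\Xi\to\mathbb R$ and $p=(p_1,\dots,p_J)^T:\Xi\to\mathbb R^J$ be measurable. Let $e\in\mathbb R^J$ be the all-ones vector and $\Pi(\xi)=\gamma(\xi)(ee^T+I)$. For vectors $u,v$, write $0\le u\perp v\ge 0$ for $u\ge 0$, $v\ge 0$ (componentwise) and $u^Tv=0$. Let $S^*$ be the set of first-stage solutions of the two-stage stochastic complementarity problem, i.e. of all $x\in\mathbb R^J$ for which there are $y\in L^\infty(\Xi,P;\mathbb R^J)$ and $\lambda\in L^1(\Xi,P;\mathbb R^J)$ with $$0\le x\perp Cx-\mathbb E[\lambda(\xi)]+a\ge 0,$$ $$0\le\begin{pmatrix}y(\xi)\\ \lambda(\xi)\end{pmatrix}\perp\begin{pmatrix}\Pi(\xi)&I\\-I&0\end{pmatrix}\begin{pmatrix}y(\xi)\\ \lambda(\xi)\end{pmatrix}+\begin{pmatrix}-p(\xi)\\x\end{pmatrix}\ge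 0\quad\text{for a.e. }\xi\in\Xi.$$ Let $\xi_1,\xi_2,\dots$ be independent $\Xi$-valued random variables with law $P$, defined on a common probability space. For $\epsilon>0$ and $\nu\ge 1$, the regularized sample average approximation (SAA) problem is to find $x\in\mathbb R^J$ and $y_\ell,\lambda_\ell\in\mathbb R^J$, $\ell=1,\dots,\nu$, with $$0\le x\perp Cx-\frac1\nu\sum_{\ell=1}^\nu\lambda_\ell+a\ge 0,$$ $$0\le\begin{pmatrix}y_\ell\\ \lambda_\ell\end{pmatrix}\perp\begin{pmatrix}\Pi(\xi_\ell)&I\\-I&\epsilon I\end{pmatrix}\begin{pmatrix}y_\ell\\ \lambda_\ell\end{pmatrix}+\begin{pmatrix}-p(\xi_\ell)\\x\end{pmatrix}\ge 0,\quad \ell=1,\dots,\nu.$$ **Theorem.** Suppose that there is $\gamma_0>0$ with $\gamma(\xi)\ge\gamma_0$ for a.e. $\xi\in\Xi$, and that there is $p_0>0$ with $p_j(\xi)\le p_0$ for a.e. $\xi\in\Xi$ and every $j$. Then, with probability $1$, the following holds. For all $\epsilon>0$ and $\nu\ge1$ the regularized SAA problem has exactly one solution; let $x^\epsilon_\nu$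 be its $x$-component. For every $\epsilon>0$ the limit $\lim_{\nu\to\infty}x^\epsilon_\nu$ exists, and $$\limsup_{\epsilon\downarrow0}\,\lim_{\nu\to\infty}x^\epsilon_\nu\subseteq S^*,$$ where the left-hand side is the outer limit, i.e. the set of all $\bar x\in\mathbb R^J$ such that $\lim_{\nu\to\infty}x^{\epsilon_k}_\nu\to\bar x$ as $k\to\infty$ for some sequence $\epsilon_k>0$ with $\epsilon_k\to0$. -/

import Mathlib

open MeasureTheory ProbabilityTheory Filter Topology

noncomputable section

namespace TwoStageSCP

/-- The complementarity relation `0 ≤ u ⊥ v ≥ 0` for real vectors. -/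
def Complementary {ι : Type*} [Fintype ι] (u v : ι → ℝ) : Prop :=
  0 ≤ u ∧ 0 ≤ v ∧ u ⬝ᵥ v = 0

/-- `z` solves the linear complementarity problem `LCP(q, M)`: `0 ≤ z ⊥ M z + q ≥ 0`. -/
def SolvesLCP {ι : Type*} [Fintype ι] (q : ι → ℝ) (M : Matrix ι ι ℝ) (z : ι → ℝ) : Prop :=
  Complementary z (M.mulVec z + q)

/-- The matrix `γ (e eᵀ + I)`, where `e` is the all-ones vector and `γ` a number. -/
def supplyMatrix (J : ℕ) (g : ℝ) : Matrix (Fin J) (Fin J) ℝ :=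
  g • (Matrix.vecMulVec (fun _ => (1 : ℝ)) (fun _ => (1 : ℝ)) + 1)

/-- The second-stage block matrix with rows `(γ (e eᵀ + I), I)` and `(-I, 0)`. -/
def secondStageMatrix (J : ℕ) (g : ℝ) : Matrix (Fin J ⊕ Fin J) (Fin J ⊕ Fin J) ℝ :=
  Matrix.fromBlocks (supplyMatrix J g) 1 (-1) 0

/-- The regularized block matrix with rows `(γ (e eᵀ + I), I)` and `(-I, ε I)`. -/
def regSecondStageMatrix (J : ℕ) (ε g : ℝ) : Matrix (Fin J ⊕ Fin J) (Fin J ⊕ Fin J) ℝ :=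
  Matrix.fromBlocks (supplyMatrix J g) 1 (-1) (ε • (1 : Matrix (Fin J) (Fin J) ℝ))

/-- `(x, y, lam)`, with `y` essentially bounded and `lam` integrable, solves the two-stage
stochastic complementarity problem
`0 ≤ x ⊥ C x - 𝔼[lam(ξ)] + a ≥ 0`, and, for almost every `ξ`, `(y(ξ), lam(ξ))` solves
`LCP((-p(ξ), x), M(ξ))`. Here `C = diag(c₁, …, c_J)`. -/
structure IsSolution {J : ℕ} {Ξ : Type*} [MeasurableSpace Ξ] (P : Measure Ξ)
    (c a : Fin J → ℝ) (γ : Ξ → ℝ) (p : Ξ → Fin J → ℝ)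
    (x : Fin J → ℝ) (y lam : Ξ → Fin J → ℝ) : Prop where
  memLp_y : MemLp y ⊤ P
  memLp_lam : MemLp lam 1 P
  firstStage : Complementary x ((Matrix.diagonal c).mulVec x - (∫ s, lam s ∂P) + a)
  secondStage : ∀ᵐ s ∂P,
    SolvesLCP (Sum.elim (-p s) x) (secondStageMatrix J (γ s)) (Sum.elim (y s) (lam s))

/-- The first-stage solution set `S*` of the two-stage stochastic complementarity problem. -/
def firstStageSolutions {J : ℕ} {Ξ : Type*} [MeasurableSpace Ξ] (P : Measure Ξ)
    (c a : Fin J → ℝ) (γ : Ξ → ℝ) (p : Ξ → Fin J → ℝ) : Set (Fin J → ℝ) :=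
  {x | ∃ y lam : Ξ → Fin J → ℝ, IsSolution P c a γ p x y lam}

/-- `(x, y, lam)` solves the regularized sample average approximation with parameter `ε` for the
sample points `s 0, …, s (ν - 1)`; `y ℓ` and `lam ℓ` are the second-stage decision and multiplier
at the sample point `s ℓ`. -/
structure IsSAASolution {J : ℕ} {Ξ : Type*}
    (c a : Fin J → ℝ) (γ : Ξ → ℝ) (p : Ξ → Fin J → ℝ) (ε : ℝ) (ν : ℕ) (s : Fin ν → Ξ)
    (x : Fin J → ℝ) (y lam : Fin ν → Fin J → ℝ) : Prop where
  firstStage : Complementary x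
    ((Matrix.diagonal c).mulVec x - (1 / (ν : ℝ)) • (∑ l, lam l) + a)
  secondStage : ∀ l, SolvesLCP (Sum.elim (-p (s l)) x)
    (regSecondStageMatrix J ε (γ (s l))) (Sum.elim (y l) (lam l))

/-- The outer limit, as `ε ↓ 0`, of the points `f ε`: the set of all limits of sequences
`f (e k)` with `e k > 0` and `e k → 0`. -/
def outerLimit {E : Type*} [TopologicalSpace E] (f : ℝ → E) : Set E :=
  {x | ∃ e : ℕ → ℝ, (∀ k, 0 < e k) ∧ Tendsto e atTop (𝓝 0) ∧
    Tendsto (fun k => f (e k)) atTop (𝓝 x)}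

end TwoStageSCP

end

noncomputable section

namespace TwoStageSCP

/-! ### Complementarity problems with strongly monotone maps -/

section Complementarity

variable {ι : Type*} [Fintype ι]

/-! Everything rests on monotonicity. For `ε > 0` the second-stage matrix is positive definite, so
the pair (y, λ) is unique, and `SecondStage.stability` controls it under any change of the data. In
particular λ is an antitone, Lipschitz function of x. Hence, for every probability measure Q,
averaging λ over Q leaves a strongly monotone Lipschitz complementarity problem for x, with a unique
solution. The SAA problem is the case where Q is the empirical measure.

Letting ν → ∞: `firstStage_stability` bounds the distance of two first-stage solutions by the
difference of the averaged multipliers at one of them. The strong law is therefore needed only at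
the fixed solution for P, and no uniform law is required. A single null set serves all `ε`: the
strong law is applied for rational `ε`, and `norm_regFirstStage_sub_le` extends the convergence to
real `ε` because its constant does not depend on the measure.

Letting ε → 0: the Lipschitz constant of λ in x blows up, but y and λ stay bounded, so y is Cauchy
along the sequence (`norm_decision_sub_sq_le`). Since λ = max(p - Πy, 0) does not involve `ε`
(`SecondStage.multiplier_eq`), λ converges pointwise as well, and dominated convergence passes to
the limit in the first stage. -/

lemma norm_sq_le_dotProduct_self (u : ι → ℝ) : ‖u‖ ^ 2 ≤ u ⬝ᵥ u := by
  have h0 : 0 ≤ u ⬝ᵥ u := Finset.sum_nonneg fun i _ => mul_self_nonneg _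
  have : ‖u‖ ≤ √(u ⬝ᵥ u) := by
    refine (pi_norm_le_iff_of_nonneg (Real.sqrt_nonneg _)).2 fun i => ?_
    refine Real.abs_le_sqrt ?_
    rw [sq]
    exact Finset.single_le_sum (f := fun i => u i * u i) (fun i _ => mul_self_nonneg _)
      (Finset.mem_univ i)
  calc ‖u‖ ^ 2 ≤ √(u ⬝ᵥ u) ^ 2 := by gcongr
    _ = u ⬝ᵥ u := Real.sq_sqrt h0

/-- The norm on `ι → ℝ` is the sup norm, not the one of the pairing; this is the source of the
factors `J` in the later bounds. -/
lemma dotProduct_le_card_mul (u v : ι → ℝ) : u ⬝ᵥ v ≤ Fintype.card ι * (‖u‖ * ‖v‖) := by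
  calc u ⬝ᵥ v ≤ ∑ _i : ι, ‖u‖ * ‖v‖ := by
        refine Finset.sum_le_sum fun i _ => ?_
        calc u i * v i ≤ ‖u i‖ * ‖v i‖ := by
              rw [← norm_mul]; exact Real.le_norm_self _
          _ ≤ ‖u‖ * ‖v‖ := by gcongr <;> exact norm_le_pi_norm _ i
    _ = _ := by simp

lemma Complementary.mul_eq_zero {u v : ι → ℝ} (h : Complementary u v) (i : ι) :
    u i * v i = 0 :=
  (Finset.sum_eq_zero_iff_of_nonneg fun i _ => mul_nonneg (h.1 i) (h.2.1 i)).1 h.2.2 i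
    (Finset.mem_univ i)

lemma complementary_of_forall {u v : ι → ℝ} (hu : 0 ≤ u) (hv : 0 ≤ v)
    (h : ∀ i, u i * v i = 0) : Complementary u v :=
  ⟨hu, hv, Finset.sum_eq_zero fun i _ => h i⟩

lemma complementary_sum_elim_iff {κ : Type*} [Fintype κ] {u u' : ι → ℝ} {v v' : κ → ℝ} :
    Complementary (Sum.elim u v) (Sum.elim u' v') ↔
      Complementary u u' ∧ Complementary v v' := by
  constructor
  · intro h
    exact ⟨complementary_of_forall (fun i => h.1 (.inl i)) (fun i => h.2.1 (.inl i))
        fun i => h.mul_eq_zero (.inl i),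
      complementary_of_forall (fun i => h.1 (.inr i)) (fun i => h.2.1 (.inr i))
        fun i => h.mul_eq_zero (.inr i)⟩
  · rintro ⟨h, h'⟩
    refine complementary_of_forall ?_ ?_ ?_
    · rintro (i | i); exacts [h.1 i, h'.1 i]
    · rintro (i | i); exacts [h.2.1 i, h'.2.1 i]
    · rintro (i | i); exacts [h.mul_eq_zero i, h'.mul_eq_zero i]

/-- The complementarity relation is monotone. -/
lemma Complementary.sub_dotProduct_sub_nonpos {u v u' v' : ι → ℝ} (h : Complementary u v)
    (h' : Complementary u' v') : (u - u') ⬝ᵥ (v - v') ≤ 0 := by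
  have h1 : 0 ≤ u ⬝ᵥ v' := Finset.sum_nonneg fun i _ => mul_nonneg (h.1 i) (h'.2.1 i)
  have h2 : 0 ≤ u' ⬝ᵥ v := Finset.sum_nonneg fun i _ => mul_nonneg (h'.1 i) (h.2.1 i)
  rw [sub_dotProduct, dotProduct_sub, dotProduct_sub, h.2.2, h'.2.2]
  linarith

lemma Complementary.of_tendsto {β : Type*} {l : Filter β} [l.NeBot] {u v : β → ι → ℝ}
    {u₀ v₀ : ι → ℝ} (h : ∀ k, Complementary (u k) (v k)) (hu : Tendsto u l (𝓝 u₀))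
    (hv : Tendsto v l (𝓝 v₀)) : Complementary u₀ v₀ := by
  rw [tendsto_pi_nhds] at hu hv
  refine complementary_of_forall (fun i => ge_of_tendsto' (hu i) fun k => (h k).1 i)
    (fun i => ge_of_tendsto' (hv i) fun k => (h k).2.1 i) fun i => ?_
  refine tendsto_nhds_unique ((hu i).mul (hv i)) ?_
  simp only [fun k => (h k).mul_eq_zero i]
  exact tendsto_const_nhds

/-- A nonlinear complementarity problem with a strongly monotone Lipschitz map is solvable. -/
theorem exists_complementary {F : (ι → ℝ) → ι → ℝ} {m L : ℝ} (hm : 0 < m) (hL : 0 ≤ L)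
    (hmono : ∀ u v, m * ((u - v) ⬝ᵥ (u - v)) ≤ (u - v) ⬝ᵥ (F u - F v))
    (hlip : ∀ u v, (F u - F v) ⬝ᵥ (F u - F v) ≤ L * ((u - v) ⬝ᵥ (u - v))) :
    ∃ z, Complementary z (F z) := by
  -- Step length of the projected iteration. Its squared contraction factor 1 - 2τm + τ²L is at most
  -- `k < 1`; the summand m² keeps the denominator positive when `L = 0`.
  set τ : ℝ := m / (L + m ^ 2) with hτ
  have hD : 0 < L + m ^ 2 := by positivity
  have hτ0 : 0 < τ := by positivity
  set k : ℝ := L / (L + m ^ 2) with hk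
  have hk0 : 0 ≤ k := by positivity
  have hk1 : k < 1 := (div_lt_one hD).2 (by nlinarith [pow_pos hm 2])
  -- Fixed points of z ↦ (z - τ F z)₊ are the solutions. The Euclidean metric is needed, since
  -- strong monotonicity yields a contraction only there.
  let T : EuclideanSpace ℝ ι → EuclideanSpace ℝ ι :=
    fun z => WithLp.toLp 2 fun i => max (z.ofLp i - τ * F z.ofLp i) 0
  have hdist : ∀ z w : EuclideanSpace ℝ ι,
      dist z w = √((z.ofLp - w.ofLp) ⬝ᵥ (z.ofLp - w.ofLp)) := by
    intro z w
    rw [EuclideanSpace.dist_eq]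
    congr 1
    refine Finset.sum_congr rfl fun i _ => ?_
    rw [Real.dist_eq, sq_abs, sq]; rfl
  have hT : ContractingWith (Real.toNNReal √k) T := by
    refine ⟨?_, LipschitzWith.of_dist_le_mul fun z w => ?_⟩
    · rw [Real.toNNReal_lt_one]
      exact (Real.sqrt_lt' one_pos).2 (by simpa using hk1)
    rw [Real.coe_toNNReal _ (Real.sqrt_nonneg _), hdist, hdist, ← Real.sqrt_mul hk0]
    refine Real.sqrt_le_sqrt ?_
    set u := z.ofLp
    set v := w.ofLp
    have h1 : ((T z).ofLp - (T w).ofLp) ⬝ᵥ ((T z).ofLp - (T w).ofLp) ≤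
        ((u - v) - τ • (F u - F v)) ⬝ᵥ ((u - v) - τ • (F u - F v)) := by
      refine Finset.sum_le_sum fun i _ => ?_
      simp only [Pi.sub_apply, Pi.smul_apply, smul_eq_mul, T]
      have := abs_max_sub_max_le_abs (u i - τ * F u i) (v i - τ * F v i) 0
      rw [← sq, ← sq]
      refine sq_le_sq.2 (this.trans_eq ?_)
      rw [mul_sub, sub_sub_sub_comm]
    have h2 : ((u - v) - τ • (F u - F v)) ⬝ᵥ ((u - v) - τ • (F u - F v)) =
        (u - v) ⬝ᵥ (u - v) - 2 * τ * ((u - v) ⬝ᵥ (F u - F v)) +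
          τ ^ 2 * ((F u - F v) ⬝ᵥ (F u - F v)) := by
      generalize u - v = b
      generalize F u - F v = d
      rw [sub_dotProduct, dotProduct_sub, dotProduct_sub, smul_dotProduct, smul_dotProduct,
        dotProduct_smul, dotProduct_smul, dotProduct_comm d b]
      simp only [smul_eq_mul]
      ring
    have h0 : 0 ≤ (u - v) ⬝ᵥ (u - v) := Finset.sum_nonneg fun i _ => mul_self_nonneg _
    have h3 := mul_le_mul_of_nonneg_left (hmono u v) (by positivity : 0 ≤ 2 * τ)
    have h4 := mul_le_mul_of_nonneg_left (hlip u v) (by positivity : 0 ≤ τ ^ 2)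
    have h5 : 1 - 2 * τ * m + τ ^ 2 * L ≤ k := by
      have : k - (1 - 2 * τ * m + τ ^ 2 * L) = m ^ 4 / (L + m ^ 2) ^ 2 := by
        rw [hτ, hk]; field_simp; ring
      have h6 : 0 ≤ m ^ 4 / (L + m ^ 2) ^ 2 := by positivity
      linarith
    have h6 := mul_le_mul_of_nonneg_right h5 h0
    rw [h2] at h1
    refine h1.trans ?_
    linarith
  have hfix := hT.fixedPoint_isFixedPt
  set z := hT.fixedPoint T
  have hz : ∀ i, z.ofLp i = max (z.ofLp i - τ * F z.ofLp i) 0 := fun i =>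
    (congrArg (fun w : EuclideanSpace ℝ ι => w.ofLp i) hfix).symm
  refine ⟨z.ofLp, complementary_of_forall (fun i => ?_) (fun i => ?_) fun i => ?_⟩
  · rw [hz i]; exact le_max_right _ _
  · have : z.ofLp i - τ * F z.ofLp i ≤ z.ofLp i := (le_max_left _ _).trans (hz i).ge
    exact nonneg_of_mul_nonneg_right (by linarith) hτ0
  · rcases le_total (z.ofLp i - τ * F z.ofLp i) 0 with h | h
    · have := hz i
      rw [max_eq_right h] at this
      rw [this, zero_mul]
    · have := hz i
      rw [max_eq_left h] at this
      have : τ * F z.ofLp i = 0 := by linarith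
      rw [(mul_eq_zero.1 this).resolve_left hτ0.ne', mul_zero]

lemma mulVec_dotProduct_self_le (M : Matrix ι ι ℝ) (u : ι → ℝ) :
    M.mulVec u ⬝ᵥ M.mulVec u ≤ (∑ i, ∑ j, M i j ^ 2) * (u ⬝ᵥ u) := by
  rw [Finset.sum_mul]
  refine Finset.sum_le_sum fun i _ => ?_
  have := Finset.sum_mul_sq_le_sq_mul_sq Finset.univ (M i) u
  simp only [dotProduct, Matrix.mulVec]
  calc _ = (∑ j, M i j * u j) ^ 2 := (sq _).symm
    _ ≤ _ := this
    _ = _ := by simp only [sq]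

/-- The linear complementarity problem of a positive definite matrix is solvable. -/
theorem exists_solvesLCP {M : Matrix ι ι ℝ} {m : ℝ} (hm : 0 < m)
    (hM : ∀ u, m * (u ⬝ᵥ u) ≤ u ⬝ᵥ M.mulVec u) (q : ι → ℝ) : ∃ z, SolvesLCP q M z := by
  refine exists_complementary (F := fun z => M.mulVec z + q) hm
    (L := ∑ i, ∑ j, M i j ^ 2) (by positivity) (fun u v => ?_) fun u v => ?_
  · rw [add_sub_add_right_eq_sub, ← Matrix.mulVec_sub]; exact hM _
  · rw [add_sub_add_right_eq_sub, ← Matrix.mulVec_sub]; exact mulVec_dotProduct_self_le _ _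

end Complementarity

/-! ### The second stage: solvability, bounds, stability -/

section SecondStage

variable {J : ℕ}

lemma dotProduct_supplyMatrix_mulVec {g : ℝ} (hg : 0 ≤ g) (u : Fin J → ℝ) :
    g * (u ⬝ᵥ u) ≤ u ⬝ᵥ (supplyMatrix J g).mulVec u := by
  rw [supplyMatrix, Matrix.smul_mulVec, Matrix.add_mulVec, Matrix.one_mulVec,
    Matrix.vecMulVec_mulVec, dotProduct_smul, dotProduct_add, smul_eq_mul]
  refine mul_le_mul_of_nonneg_left (le_add_of_nonneg_left ?_) hg
  rw [dotProduct_smul]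
  have : u ⬝ᵥ (fun _ => (1 : ℝ)) = (fun _ => (1 : ℝ)) ⬝ᵥ u := dotProduct_comm _ _
  rw [this]
  exact mul_self_nonneg _

lemma supplyMatrix_mulVec_apply (g : ℝ) (u : Fin J → ℝ) (j : Fin J) :
    (supplyMatrix J g).mulVec u j = g * (∑ i, u i + u j) := by
  rw [supplyMatrix, Matrix.smul_mulVec, Matrix.add_mulVec, Matrix.one_mulVec,
    Matrix.vecMulVec_mulVec]
  simp [dotProduct]

lemma supplyMatrix_eq_smul (g : ℝ) : supplyMatrix J g = g • supplyMatrix J 1 := by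
  simp [supplyMatrix]

/-- The second-stage complementarity system with regularization parameter `ε` (unregularized if
`ε = 0`), written out as two complementarity relations. -/
def SecondStage (ε g : ℝ) (p x y lam : Fin J → ℝ) : Prop :=
  Complementary y ((supplyMatrix J g).mulVec y + lam - p) ∧ Complementary lam (ε • lam - y + x)

lemma solvesLCP_regSecondStageMatrix_iff {ε g : ℝ} {p x y lam : Fin J → ℝ} :
    SolvesLCP (Sum.elim (-p) x) (regSecondStageMatrix J ε g) (Sum.elim y lam) ↔
      SecondStage ε g p x y lam := by
  have : (regSecondStageMatrix J ε g).mulVec (Sum.elim y lam) + Sum.elim (-p) x =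
      Sum.elim ((supplyMatrix J g).mulVec y + lam - p) (ε • lam - y + x) := by
    rw [regSecondStageMatrix, Matrix.fromBlocks_mulVec]
    ext (i | i)
    · simp [sub_eq_add_neg]
    · simp [Matrix.neg_mulVec, Matrix.smul_mulVec]; ring
  rw [SolvesLCP, this, complementary_sum_elim_iff, SecondStage]

lemma secondStageMatrix_eq (g : ℝ) : secondStageMatrix J g = regSecondStageMatrix J 0 g := by
  simp [secondStageMatrix, regSecondStageMatrix]

/-- The blocks I and -I cancel in the quadratic form, so the regularized matrix is positive definite
with constant `min g ε`. -/
lemma SecondStage.exists {ε g : ℝ} (hε : 0 < ε) (hg : 0 < g) (p x : Fin J → ℝ) :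
    ∃ z : (Fin J → ℝ) × (Fin J → ℝ), SecondStage ε g p x z.1 z.2 := by
  have hM : ∀ u, min g ε * (u ⬝ᵥ u) ≤ u ⬝ᵥ (regSecondStageMatrix J ε g).mulVec u := by
    intro u
    obtain ⟨y, l, rfl⟩ : ∃ y l, u = Sum.elim y l :=
      ⟨u ∘ Sum.inl, u ∘ Sum.inr, (Sum.elim_comp_inl_inr u).symm⟩
    rw [regSecondStageMatrix, Matrix.fromBlocks_mulVec, sumElim_dotProduct_sumElim,
      sumElim_dotProduct_sumElim]
    simp only [Sum.elim_comp_inl, Sum.elim_comp_inr, Matrix.one_mulVec, Matrix.neg_mulVec,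
      Matrix.smul_mulVec, dotProduct_add, dotProduct_neg, dotProduct_smul, smul_eq_mul]
    have h1 := dotProduct_supplyMatrix_mulVec hg.le y
    have h2 : 0 ≤ y ⬝ᵥ y := Finset.sum_nonneg fun i _ => mul_self_nonneg _
    have h3 : 0 ≤ l ⬝ᵥ l := Finset.sum_nonneg fun i _ => mul_self_nonneg _
    have h4 := mul_le_mul_of_nonneg_right (min_le_left g ε) h2
    have h5 := mul_le_mul_of_nonneg_right (min_le_right g ε) h3
    rw [dotProduct_comm l y]
    linarith
  obtain ⟨z, hz⟩ := exists_solvesLCP (lt_min hg hε) hM (Sum.elim (-p) x)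
  refine ⟨(z ∘ Sum.inl, z ∘ Sum.inr), solvesLCP_regSecondStageMatrix_iff.1 ?_⟩
  rwa [Sum.elim_comp_inl_inr]

/-- The basic stability estimate for the second stage. -/
lemma SecondStage.stability {ε₁ ε₂ g₁ g₂ : ℝ} {p₁ p₂ x₁ x₂ y₁ y₂ l₁ l₂ : Fin J → ℝ} (hg : 0 ≤ g₁)
    (h₁ : SecondStage ε₁ g₁ p₁ x₁ y₁ l₁) (h₂ : SecondStage ε₂ g₂ p₂ x₂ y₂ l₂) :
    g₁ * ((y₁ - y₂) ⬝ᵥ (y₁ - y₂)) + ε₁ * ((l₁ - l₂) ⬝ᵥ (l₁ - l₂)) ≤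
      (y₁ - y₂) ⬝ᵥ (p₁ - p₂ - (g₁ - g₂) • (supplyMatrix J 1).mulVec y₂) +
        (l₁ - l₂) ⬝ᵥ ((ε₂ - ε₁) • l₂ + (x₂ - x₁)) := by
  -- The monotonicity inequalities of the two relations are added; the cross terms between y and λ
  -- cancel.
  have h1 := h₁.1.sub_dotProduct_sub_nonpos h₂.1
  have h2 := h₁.2.sub_dotProduct_sub_nonpos h₂.2
  have h3 := dotProduct_supplyMatrix_mulVec hg (y₁ - y₂)
  have e1 : (supplyMatrix J g₁).mulVec y₁ + l₁ - p₁ - ((supplyMatrix J g₂).mulVec y₂ + l₂ - p₂) =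
      (supplyMatrix J g₁).mulVec (y₁ - y₂) + (l₁ - l₂) -
        (p₁ - p₂ - (g₁ - g₂) • (supplyMatrix J 1).mulVec y₂) := by
    rw [supplyMatrix_eq_smul g₁, supplyMatrix_eq_smul g₂, Matrix.mulVec_sub]
    simp only [Matrix.smul_mulVec, sub_smul]
    abel
  have e2 : ε₁ • l₁ - y₁ + x₁ - (ε₂ • l₂ - y₂ + x₂) =
      ε₁ • (l₁ - l₂) - (y₁ - y₂) - ((ε₂ - ε₁) • l₂ + (x₂ - x₁)) := by
    simp only [sub_smul, smul_sub]
    abel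
  rw [e1, dotProduct_sub, dotProduct_add] at h1
  rw [e2, dotProduct_sub, dotProduct_sub, dotProduct_smul, smul_eq_mul,
    dotProduct_comm (l₁ - l₂) (y₁ - y₂)] at h2
  linarith

/-- If λ_j > 0, then y_j = x_j + ελ_j is positive, which makes the first relation an equality; if
λ_j = 0, that relation's inequality says p_j ≤ (Πy)_j. Although `ε > 0` is used, the formula is free
of `ε` and so survives the limit. -/
lemma SecondStage.multiplier_eq {ε g : ℝ} {p x y lam : Fin J → ℝ} (hε : 0 < ε) (hx : 0 ≤ x)
    (h : SecondStage ε g p x y lam) (j : Fin J) :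
    lam j = max (p j - (supplyMatrix J g).mulVec y j) 0 := by
  have hy := h.1.1 j
  have hl := h.2.1 j
  have h1 := h.1.2.1 j
  have m1 := h.1.mul_eq_zero j
  have m2 := h.2.mul_eq_zero j
  have hxj := hx j
  simp only [Pi.zero_apply, Pi.sub_apply, Pi.add_apply, Pi.smul_apply, smul_eq_mul] at *
  rcases hl.eq_or_lt with hl0 | hl0
  · rw [max_eq_right (by linarith)]; exact hl0.symm
  · have e2 := (mul_eq_zero.1 m2).resolve_left hl0.ne'
    have hy0 : y j ≠ 0 := by nlinarith [mul_pos hε hl0]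
    have e1 := (mul_eq_zero.1 m1).resolve_left hy0
    rw [max_eq_left (by linarith)]; linarith

/-- Since Πy ≥ 0, the formula for λ gives a bound uniform in `ε`, which serves as the dominating
function as `ε` vanishes. -/
lemma SecondStage.norm_multiplier_le {ε g p₀ : ℝ} {p x y lam : Fin J → ℝ} (hε : 0 < ε)
    (hg : 0 ≤ g) (hx : 0 ≤ x) (hp₀ : 0 ≤ p₀) (hp : ∀ j, p j ≤ p₀)
    (h : SecondStage ε g p x y lam) : ‖lam‖ ≤ p₀ := by
  refine (pi_norm_le_iff_of_nonneg hp₀).2 fun j => ?_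
  rw [Real.norm_of_nonneg (h.2.1 j), h.multiplier_eq hε hx j]
  refine max_le ?_ hp₀
  have : 0 ≤ (supplyMatrix J g).mulVec y j := by
    rw [supplyMatrix_mulVec_apply]
    exact mul_nonneg hg (add_nonneg (Finset.sum_nonneg fun i _ => h.1.1 i) (h.1.1 j))
  linarith [hp j]

/-- Where y_j > 0 the first relation is an equality, and its diagonal term alone gives γ₀ y_j ≤ p₀.
-/
lemma SecondStage.norm_decision_le {ε g γ₀ p₀ : ℝ} {p x y lam : Fin J → ℝ}
    (hγ₀ : 0 < γ₀) (hg : γ₀ ≤ g) (hp₀ : 0 ≤ p₀) (hp : ∀ j, p j ≤ p₀)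
    (h : SecondStage ε g p x y lam) : ‖y‖ ≤ p₀ / γ₀ := by
  have hq : 0 ≤ p₀ / γ₀ := by positivity
  refine (pi_norm_le_iff_of_nonneg hq).2 fun j => ?_
  have hyj : 0 ≤ y j := h.1.1 j
  rw [Real.norm_of_nonneg hyj]
  rcases hyj.eq_or_lt with h0 | h0
  · rw [← h0]; exact hq
  have e1 := (mul_eq_zero.1 (h.1.mul_eq_zero j)).resolve_left h0.ne'
  have hl : 0 ≤ lam j := h.2.1 j
  have hs : 0 ≤ ∑ i, y i := Finset.sum_nonneg fun i _ => h.1.1 i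
  simp only [Pi.sub_apply, Pi.add_apply, supplyMatrix_mulVec_apply] at e1
  rw [le_div_iff₀ hγ₀]
  have h2 : γ₀ * y j ≤ g * (∑ i, y i + y j) := by
    gcongr
    · exact hγ₀.le.trans hg
    · exact le_add_of_nonneg_left hs
  linarith [hp j]

open Classical in
/-- The solution `(y, lam)` of the regularized second-stage system (zero if there is none). -/
def secondStageSol (ε g : ℝ) (p x : Fin J → ℝ) : (Fin J → ℝ) × (Fin J → ℝ) :=
  if h : ∃ z : (Fin J → ℝ) × (Fin J → ℝ), SecondStage ε g p x z.1 z.2 then h.choose else 0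

lemma secondStage_secondStageSol {ε g : ℝ} (hε : 0 < ε) (hg : 0 < g) (p x : Fin J → ℝ) :
    SecondStage ε g p x (secondStageSol ε g p x).1 (secondStageSol ε g p x).2 := by
  have h := SecondStage.exists hε hg p x
  rw [secondStageSol, dif_pos h]
  exact h.choose_spec

lemma SecondStage.unique {ε g : ℝ} {p x y₁ y₂ l₁ l₂ : Fin J → ℝ} (hε : 0 < ε) (hg : 0 < g)
    (h₁ : SecondStage ε g p x y₁ l₁) (h₂ : SecondStage ε g p x y₂ l₂) : y₁ = y₂ ∧ l₁ = l₂ := by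
  have h := h₁.stability hg.le h₂
  simp only [sub_self, zero_smul, add_zero, dotProduct_zero] at h
  have n1 := norm_sq_le_dotProduct_self (y₁ - y₂)
  have n2 := norm_sq_le_dotProduct_self (l₁ - l₂)
  have n3 := mul_le_mul_of_nonneg_left n1 hg.le
  have n4 := mul_le_mul_of_nonneg_left n2 hε.le
  constructor
  · have : g * ‖y₁ - y₂‖ ^ 2 = 0 := le_antisymm (by nlinarith [sq_nonneg ‖l₁ - l₂‖])
      (by positivity)
    simpa [hg.ne', sub_eq_zero] using this
  · have : ε * ‖l₁ - l₂‖ ^ 2 = 0 := le_antisymm (by nlinarith [sq_nonneg ‖y₁ - y₂‖])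
      (by positivity)
    simpa [hε.ne', sub_eq_zero] using this

lemma le_of_mul_sq_le {m t R : ℝ} (hR : 0 ≤ R) (ht : 0 ≤ t) (h : m * t ^ 2 ≤ t * R) :
    m * t ≤ R := by
  rcases ht.eq_or_lt with rfl | ht
  · simpa using hR
  · exact le_of_mul_le_mul_right (by linarith [h, sq t, mul_assoc m t t, mul_comm R t]) ht

/-- For data with `g` bounded away from `0`, the second-stage solution depends continuously on
the data. -/
lemma continuous_secondStageSol {ε γ₀ : ℝ} (hε : 0 < ε) (hγ₀ : 0 < γ₀) (x : Fin J → ℝ) :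
    Continuous fun d : ℝ × (Fin J → ℝ) => secondStageSol ε (max d.1 γ₀) d.2 x := by
  have hpos : ∀ g, 0 < max g γ₀ := fun g => hγ₀.trans_le (le_max_right _ _)
  refine continuous_iff_continuousAt.2 fun d₀ => ?_
  set z₀ := secondStageSol ε (max d₀.1 γ₀) d₀.2 x
  set m := min γ₀ ε
  have hm : 0 < m := lt_min hγ₀ hε
  -- The perturbation term of the stability estimate against the fixed solution at `d₀`; it vanishes
  -- as `d` tends to `d₀`.
  let w : ℝ × (Fin J → ℝ) → Fin J → ℝ := fun d =>
    d.2 - d₀.2 - (max d.1 γ₀ - max d₀.1 γ₀) • (supplyMatrix J 1).mulVec z₀.1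
  have hw : Tendsto (fun d => J * ‖w d‖ / m) (𝓝 d₀) (𝓝 0) := by
    have : Continuous fun d => (J : ℝ) * ‖w d‖ / m := by fun_prop
    have h := this.tendsto d₀
    simpa [w] using h
  refine tendsto_iff_norm_sub_tendsto_zero.2 (squeeze_zero (fun _ => norm_nonneg _) ?_ hw)
  intro d
  set z := secondStageSol ε (max d.1 γ₀) d.2 x with hz
  have h := (secondStage_secondStageSol hε (hpos d.1) d.2 x).stability (hpos d.1).le
    (secondStage_secondStageSol hε (hpos d₀.1) d₀.2 x)
  rw [sub_self x, sub_self ε, zero_smul, add_zero, dotProduct_zero, add_zero] at h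
  have h1 := norm_sq_le_dotProduct_self (z.1 - z₀.1)
  have h2 := norm_sq_le_dotProduct_self (z.2 - z₀.2)
  have h3 := dotProduct_le_card_mul (z.1 - z₀.1) (w d)
  rw [Fintype.card_fin] at h3
  have hn1 : ‖z.1 - z₀.1‖ ≤ ‖z - z₀‖ := norm_fst_le (z - z₀)
  rw [le_div_iff₀ hm, mul_comm]
  refine le_of_mul_sq_le (by positivity) (norm_nonneg _) ?_
  have h4 : ‖z - z₀‖ ^ 2 ≤ ‖z.1 - z₀.1‖ ^ 2 + ‖z.2 - z₀.2‖ ^ 2 := by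
    rw [Prod.norm_def]
    rcases max_choice ‖(z - z₀).1‖ ‖(z - z₀).2‖ with e | e <;> rw [e]
    · exact le_add_of_nonneg_right (sq_nonneg _)
    · exact le_add_of_nonneg_left (sq_nonneg _)
  have h5 : m * ‖z.1 - z₀.1‖ ^ 2 ≤ max d.1 γ₀ * ((z.1 - z₀.1) ⬝ᵥ (z.1 - z₀.1)) :=
    mul_le_mul ((min_le_left _ _).trans (le_max_right _ _)) h1 (sq_nonneg _) (hpos _).le
  have h6 : m * ‖z.2 - z₀.2‖ ^ 2 ≤ ε * ((z.2 - z₀.2) ⬝ᵥ (z.2 - z₀.2)) :=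
    mul_le_mul (min_le_right _ _) h2 (sq_nonneg _) hε.le
  have h7 : (J : ℝ) * (‖z.1 - z₀.1‖ * ‖w d‖) ≤ J * (‖z - z₀‖ * ‖w d‖) := by gcongr
  have h8 := mul_le_mul_of_nonneg_left h4 hm.le
  have h9 : ‖z - z₀‖ * (↑J * ‖w d‖) = J * (‖z - z₀‖ * ‖w d‖) := by ring
  rw [h9]
  linarith

/-- The multiplier is a Lipschitz function of the first-stage decision. -/
lemma norm_multiplier_sub_le {ε g : ℝ} (hε : 0 < ε) (hg : 0 < g) (p x₁ x₂ : Fin J → ℝ) :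
    ‖(secondStageSol ε g p x₁).2 - (secondStageSol ε g p x₂).2‖ ≤ J / ε * ‖x₁ - x₂‖ := by
  have h := (secondStage_secondStageSol hε hg p x₁).stability hg.le
    (secondStage_secondStageSol hε hg p x₂)
  set z₁ := secondStageSol ε g p x₁
  set z₂ := secondStageSol ε g p x₂
  simp only [sub_self, zero_smul, dotProduct_zero, zero_add] at h
  have h1 := norm_sq_le_dotProduct_self (z₁.2 - z₂.2)
  have h2 : 0 ≤ g * ((z₁.1 - z₂.1) ⬝ᵥ (z₁.1 - z₂.1)) :=
    mul_nonneg hg.le (Finset.sum_nonneg fun i _ => mul_self_nonneg _)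
  have h3 := dotProduct_le_card_mul (z₁.2 - z₂.2) (x₂ - x₁)
  rw [Fintype.card_fin, norm_sub_rev x₂ x₁] at h3
  rw [div_mul_eq_mul_div, le_div_iff₀ hε, mul_comm]
  refine le_of_mul_sq_le (by positivity) (norm_nonneg _) ?_
  have h4 := mul_le_mul_of_nonneg_left h1 hε.le
  have h5 : ‖z₁.2 - z₂.2‖ * (↑J * ‖x₁ - x₂‖) = J * (‖z₁.2 - z₂.2‖ * ‖x₁ - x₂‖) := by ring
  rw [h5]
  linarith

/-- The multiplier is an antitone operator of the first-stage decision. -/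
lemma multiplier_sub_dotProduct_nonpos {ε g : ℝ} (hε : 0 < ε) (hg : 0 < g)
    (p x₁ x₂ : Fin J → ℝ) :
    (x₁ - x₂) ⬝ᵥ ((secondStageSol ε g p x₁).2 - (secondStageSol ε g p x₂).2) ≤ 0 := by
  have h := (secondStage_secondStageSol hε hg p x₁).stability hg.le
    (secondStage_secondStageSol hε hg p x₂)
  set z₁ := secondStageSol ε g p x₁
  set z₂ := secondStageSol ε g p x₂
  simp only [sub_self, zero_smul, dotProduct_zero, zero_add] at h
  have h2 : 0 ≤ g * ((z₁.1 - z₂.1) ⬝ᵥ (z₁.1 - z₂.1)) :=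
    mul_nonneg hg.le (Finset.sum_nonneg fun i _ => mul_self_nonneg _)
  have h3 : 0 ≤ ε * ((z₁.2 - z₂.2) ⬝ᵥ (z₁.2 - z₂.2)) :=
    mul_nonneg hε.le (Finset.sum_nonneg fun i _ => mul_self_nonneg _)
  rw [dotProduct_comm, ← neg_sub x₂ x₁, dotProduct_neg]
  linarith

/-- Dependence of the multiplier on the regularization parameter. -/
lemma norm_multiplier_sub_le_of_param {ε₁ ε₂ g p₀ : ℝ} (hε₁ : 0 < ε₁) (hε₂ : 0 < ε₂) (hg : 0 < g)
    (hp₀ : 0 ≤ p₀) {p x : Fin J → ℝ} (hp : ∀ j, p j ≤ p₀) (hx : 0 ≤ x) :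
    ε₁ * ‖(secondStageSol ε₁ g p x).2 - (secondStageSol ε₂ g p x).2‖ ≤ J * (|ε₁ - ε₂| * p₀) := by
  have h := (secondStage_secondStageSol hε₁ hg p x).stability hg.le
    (secondStage_secondStageSol hε₂ hg p x)
  have hb := (secondStage_secondStageSol hε₂ hg p x).norm_multiplier_le hε₂ hg.le hx hp₀ hp
  set z₁ := secondStageSol ε₁ g p x
  set z₂ := secondStageSol ε₂ g p x
  simp only [sub_self, zero_smul, dotProduct_zero, zero_add, add_zero] at h
  have h1 := norm_sq_le_dotProduct_self (z₁.2 - z₂.2)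
  have h2 : 0 ≤ g * ((z₁.1 - z₂.1) ⬝ᵥ (z₁.1 - z₂.1)) :=
    mul_nonneg hg.le (Finset.sum_nonneg fun i _ => mul_self_nonneg _)
  have h3 := dotProduct_le_card_mul (z₁.2 - z₂.2) ((ε₂ - ε₁) • z₂.2)
  rw [Fintype.card_fin, norm_smul, Real.norm_eq_abs, abs_sub_comm ε₂ ε₁] at h3
  refine le_of_mul_sq_le (by positivity) (norm_nonneg _) ?_
  have h4 := mul_le_mul_of_nonneg_left h1 hε₁.le
  have h5 : (J : ℝ) * (‖z₁.2 - z₂.2‖ * (|ε₁ - ε₂| * ‖z₂.2‖)) ≤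
      ‖z₁.2 - z₂.2‖ * (J * (|ε₁ - ε₂| * p₀)) := by
    calc _ ≤ (J : ℝ) * (‖z₁.2 - z₂.2‖ * (|ε₁ - ε₂| * p₀)) := by gcongr
      _ = _ := by ring
  linarith

/-- Dependence of the second-stage decision on the first-stage decision and on the
regularization parameter, with a bound that does not deteriorate as the parameter vanishes. -/
lemma norm_decision_sub_sq_le {ε₁ ε₂ g γ₀ p₀ : ℝ} (hε₁ : 0 < ε₁) (hε₂ : 0 < ε₂) (hγ₀ : 0 < γ₀)
    (hg : γ₀ ≤ g) (hp₀ : 0 ≤ p₀) {p x₁ x₂ : Fin J → ℝ} (hp : ∀ j, p j ≤ p₀) (hx₁ : 0 ≤ x₁)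
    (hx₂ : 0 ≤ x₂) :
    γ₀ * ‖(secondStageSol ε₁ g p x₁).1 - (secondStageSol ε₂ g p x₂).1‖ ^ 2 ≤
      J * (2 * p₀ * (|ε₁ - ε₂| * p₀ + ‖x₁ - x₂‖)) := by
  have hg0 := hγ₀.trans_le hg
  have s₁ := secondStage_secondStageSol hε₁ hg0 p x₁
  have s₂ := secondStage_secondStageSol hε₂ hg0 p x₂
  have h := s₁.stability hg0.le s₂
  have b₁ := s₁.norm_multiplier_le hε₁ hg0.le hx₁ hp₀ hp
  have b₂ := s₂.norm_multiplier_le hε₂ hg0.le hx₂ hp₀ hp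
  set z₁ := secondStageSol ε₁ g p x₁
  set z₂ := secondStageSol ε₂ g p x₂
  simp only [sub_self, zero_smul, dotProduct_zero, zero_add] at h
  have h1 : γ₀ * ‖z₁.1 - z₂.1‖ ^ 2 ≤ g * ((z₁.1 - z₂.1) ⬝ᵥ (z₁.1 - z₂.1)) :=
    mul_le_mul hg (norm_sq_le_dotProduct_self _) (sq_nonneg _) hg0.le
  -- This term is discarded instead of being used to absorb the multiplier difference, which is
  -- bounded by `2 * p₀`. Division by `ε₁` is avoided, at the price of a bound on the square only.
  have h2 : 0 ≤ ε₁ * ((z₁.2 - z₂.2) ⬝ᵥ (z₁.2 - z₂.2)) :=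
    mul_nonneg hε₁.le (Finset.sum_nonneg fun i _ => mul_self_nonneg _)
  have h3 := dotProduct_le_card_mul (z₁.2 - z₂.2) ((ε₂ - ε₁) • z₂.2 + (x₂ - x₁))
  rw [Fintype.card_fin] at h3
  have h4 : ‖z₁.2 - z₂.2‖ ≤ 2 * p₀ := (norm_sub_le _ _).trans (by linarith)
  have h5 : ‖(ε₂ - ε₁) • z₂.2 + (x₂ - x₁)‖ ≤ |ε₁ - ε₂| * p₀ + ‖x₁ - x₂‖ := by
    refine (norm_add_le _ _).trans ?_
    rw [norm_smul, Real.norm_eq_abs, abs_sub_comm ε₂ ε₁, norm_sub_rev x₂ x₁]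
    gcongr
  have h6 : (J : ℝ) * (‖z₁.2 - z₂.2‖ * ‖(ε₂ - ε₁) • z₂.2 + (x₂ - x₁)‖) ≤
      J * (2 * p₀ * (|ε₁ - ε₂| * p₀ + ‖x₁ - x₂‖)) := by gcongr
  linarith

end SecondStage

/-! ### The first stage with an abstract antitone multiplier -/

section FirstStage

variable {J : ℕ}

lemma sub_dotProduct_sub_self_le {ι : Type*} [Fintype ι] (u v : ι → ℝ) :
    (u - v) ⬝ᵥ (u - v) ≤ 2 * (u ⬝ᵥ u) + 2 * (v ⬝ᵥ v) := by
  simp only [dotProduct, Finset.mul_sum, ← Finset.sum_add_distrib]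
  refine Finset.sum_le_sum fun i _ => ?_
  simp only [Pi.sub_apply]
  nlinarith [sq_nonneg (u i + v i)]

lemma mul_dotProduct_self_le_diagonal {c : Fin J → ℝ} {m : ℝ} (hmc : ∀ j, m ≤ c j)
    (u : Fin J → ℝ) : m * (u ⬝ᵥ u) ≤ u ⬝ᵥ (Matrix.diagonal c).mulVec u := by
  simp only [dotProduct, Finset.mul_sum]
  refine Finset.sum_le_sum fun i _ => ?_
  rw [Matrix.mulVec_diagonal]
  nlinarith [mul_le_mul_of_nonneg_right (hmc i) (mul_self_nonneg (u i))]

lemma firstStage_sub_eq (c a u v l l' : Fin J → ℝ) :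
    (Matrix.diagonal c).mulVec u - l + a - ((Matrix.diagonal c).mulVec v - l' + a) =
      (Matrix.diagonal c).mulVec (u - v) - (l - l') := by
  rw [Matrix.mulVec_sub]; abel

/-- The first-stage problem with an antitone Lipschitz multiplier is solvable. -/
lemma exists_firstStage {c a : Fin J → ℝ} {m K : ℝ} (hm : 0 < m) (hmc : ∀ j, m ≤ c j)
    (hK : 0 ≤ K) {Λ : (Fin J → ℝ) → Fin J → ℝ}
    (hanti : ∀ u v, (u - v) ⬝ᵥ (Λ u - Λ v) ≤ 0) (hlip : ∀ u v, ‖Λ u - Λ v‖ ≤ K * ‖u - v‖) :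
    ∃ x, Complementary x ((Matrix.diagonal c).mulVec x - Λ x + a) := by
  refine exists_complementary (F := fun x => (Matrix.diagonal c).mulVec x - Λ x + a) hm
    (L := 2 * (∑ i, ∑ j, Matrix.diagonal c i j ^ 2) + 2 * (J * K ^ 2)) (by positivity)
    (fun u v => ?_) fun u v => ?_
  · simp only [firstStage_sub_eq]
    rw [dotProduct_sub (u - v) ((Matrix.diagonal c).mulVec (u - v))]
    linarith [hanti u v, mul_dotProduct_self_le_diagonal hmc (u - v)]
  · simp only [firstStage_sub_eq]
    refine (sub_dotProduct_sub_self_le _ _).trans ?_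
    have h1 := mulVec_dotProduct_self_le (Matrix.diagonal c) (u - v)
    have h2 : (Λ u - Λ v) ⬝ᵥ (Λ u - Λ v) ≤ J * K ^ 2 * ((u - v) ⬝ᵥ (u - v)) := by
      have h3 := dotProduct_le_card_mul (Λ u - Λ v) (Λ u - Λ v)
      rw [Fintype.card_fin] at h3
      calc _ ≤ (J : ℝ) * (‖Λ u - Λ v‖ * ‖Λ u - Λ v‖) := h3
        _ ≤ J * ((K * ‖u - v‖) * (K * ‖u - v‖)) := by gcongr <;> exact hlip u v
        _ = J * K ^ 2 * ‖u - v‖ ^ 2 := by ring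
        _ ≤ _ := by gcongr; exact norm_sq_le_dotProduct_self _
    linarith

/-- Stability of first-stage solutions under perturbation of the multiplier. -/
lemma firstStage_stability {c a : Fin J → ℝ} {m : ℝ} (hmc : ∀ j, m ≤ c j)
    {Λ₁ Λ₂ : (Fin J → ℝ) → Fin J → ℝ} (hm : 0 ≤ m)
    (hanti : ∀ u v, (u - v) ⬝ᵥ (Λ₁ u - Λ₁ v) ≤ 0) {x₁ x₂ : Fin J → ℝ}
    (h₁ : Complementary x₁ ((Matrix.diagonal c).mulVec x₁ - Λ₁ x₁ + a))
    (h₂ : Complementary x₂ ((Matrix.diagonal c).mulVec x₂ - Λ₂ x₂ + a)) :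
    m * ‖x₁ - x₂‖ ≤ J * ‖Λ₁ x₂ - Λ₂ x₂‖ := by
  have h := h₁.sub_dotProduct_sub_nonpos h₂
  -- Inserting `Λ₁ x₂` splits off a term of favourable sign by antitonicity of `Λ₁`; what remains is
  -- an error evaluated at `x₂` alone.
  rw [firstStage_sub_eq, ← sub_add_sub_cancel (Λ₁ x₁) (Λ₁ x₂) (Λ₂ x₂), dotProduct_sub,
    dotProduct_add] at h
  have h1 := mul_dotProduct_self_le_diagonal hmc (x₁ - x₂)
  have h2 := hanti x₁ x₂
  have h3 := dotProduct_le_card_mul (x₁ - x₂) (Λ₁ x₂ - Λ₂ x₂)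
  rw [Fintype.card_fin] at h3
  have h4 := mul_le_mul_of_nonneg_left (norm_sq_le_dotProduct_self (x₁ - x₂)) hm
  refine le_of_mul_sq_le (by positivity) (norm_nonneg _) ?_
  have h5 : ‖x₁ - x₂‖ * (J * ‖Λ₁ x₂ - Λ₂ x₂‖) = J * (‖x₁ - x₂‖ * ‖Λ₁ x₂ - Λ₂ x₂‖) := by ring
  rw [h5]
  linarith

lemma exists_pos_forall_le {c : Fin J → ℝ} (hc : ∀ j, 0 < c j) : ∃ m, 0 < m ∧ ∀ j, m ≤ c j := by
  rcases isEmpty_or_nonempty (Fin J) with h | h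
  · exact ⟨1, one_pos, fun j => h.elim j⟩
  · obtain ⟨j, hj⟩ := Finite.exists_min c
    exact ⟨c j, hc j, hj⟩

end FirstStage

/-! ### The multiplier averaged over a probability measure -/

section ExpectedMultiplier

variable {J : ℕ} {Ξ : Type*} [MeasurableSpace Ξ]

/-- The expected multiplier of the regularized second stage under the measure `Q`. -/
def expectedMultiplier (Q : Measure Ξ) (γ : Ξ → ℝ) (p : Ξ → Fin J → ℝ) (ε : ℝ)
    (x : Fin J → ℝ) : Fin J → ℝ :=
  ∫ s, (secondStageSol ε (γ s) (p s) x).2 ∂Q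

/-- Data of the second stage with bounds that hold everywhere. -/
structure IsBoundedData (γ : Ξ → ℝ) (p : Ξ → Fin J → ℝ) (γ₀ p₀ : ℝ) : Prop where
  measurable_γ : Measurable γ
  measurable_p : Measurable p
  pos_γ₀ : 0 < γ₀
  nonneg_p₀ : 0 ≤ p₀
  le_γ : ∀ s, γ₀ ≤ γ s
  p_le : ∀ s j, p s j ≤ p₀

namespace IsBoundedData

variable {γ : Ξ → ℝ} {p : Ξ → Fin J → ℝ} {γ₀ p₀ : ℝ} (h : IsBoundedData γ p γ₀ p₀)
include h

lemma γ_pos (s : Ξ) : 0 < γ s := h.pos_γ₀.trans_le (h.le_γ s)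

/-- The solution is obtained by choice; its measurability in s comes from continuous dependence on
the data. -/
lemma measurable_secondStageSol {ε : ℝ} (hε : 0 < ε) (x : Fin J → ℝ) :
    Measurable fun s => secondStageSol ε (γ s) (p s) x := by
  have := (continuous_secondStageSol hε h.pos_γ₀ x).measurable.comp
    (h.measurable_γ.prodMk h.measurable_p)
  convert this using 2 with s
  simp [max_eq_left (h.le_γ s)]

lemma measurable_multiplier {ε : ℝ} (hε : 0 < ε) (x : Fin J → ℝ) :
    Measurable fun s => (secondStageSol ε (γ s) (p s) x).2 :=
  (h.measurable_secondStageSol hε x).snd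

lemma norm_multiplier_le {ε : ℝ} (hε : 0 < ε) {x : Fin J → ℝ} (hx : 0 ≤ x) (s : Ξ) :
    ‖(secondStageSol ε (γ s) (p s) x).2‖ ≤ p₀ :=
  (secondStage_secondStageSol hε (h.γ_pos s) (p s) x).norm_multiplier_le hε (h.γ_pos s).le hx
    h.nonneg_p₀ (h.p_le s)

/-- The bound `p₀` holds only for `x ≥ 0`, while the solvability theorem needs all `x`; these are
compared with 0 through the Lipschitz estimate. -/
lemma integrable_multiplier {Q : Measure Ξ} [IsFiniteMeasure Q] {ε : ℝ} (hε : 0 < ε)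
    (x : Fin J → ℝ) : Integrable (fun s => (secondStageSol ε (γ s) (p s) x).2) Q := by
  refine Integrable.of_bound (h.measurable_multiplier hε x).aestronglyMeasurable
    (p₀ + J / ε * ‖x - 0‖) (.of_forall fun s => ?_)
  have h1 := h.norm_multiplier_le hε le_rfl s
  have h2 := norm_multiplier_sub_le hε (h.γ_pos s) (p s) x 0
  have h3 := norm_le_norm_add_norm_sub' (secondStageSol ε (γ s) (p s) x).2
    (secondStageSol ε (γ s) (p s) 0).2
  linarith

variable (Q : Measure Ξ) [IsProbabilityMeasure Q]

lemma norm_expectedMultiplier_sub_le {ε : ℝ} (hε : 0 < ε) (u v : Fin J → ℝ) :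
    ‖expectedMultiplier Q γ p ε u - expectedMultiplier Q γ p ε v‖ ≤ J / ε * ‖u - v‖ := by
  rw [expectedMultiplier, expectedMultiplier,
    ← integral_sub (h.integrable_multiplier hε u) (h.integrable_multiplier hε v)]
  refine (norm_integral_le_of_norm_le_const (.of_forall fun s =>
    norm_multiplier_sub_le hε (h.γ_pos s) (p s) u v)).trans_eq ?_
  simp

lemma sub_dotProduct_expectedMultiplier_sub_nonpos {ε : ℝ} (hε : 0 < ε) (u v : Fin J → ℝ) :
    (u - v) ⬝ᵥ (expectedMultiplier Q γ p ε u - expectedMultiplier Q γ p ε v) ≤ 0 := by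
  have hi : Integrable (fun s => (secondStageSol ε (γ s) (p s) u).2 -
      (secondStageSol ε (γ s) (p s) v).2) Q :=
    (h.integrable_multiplier hε u).sub (h.integrable_multiplier hε v)
  rw [expectedMultiplier, expectedMultiplier,
    ← integral_sub (h.integrable_multiplier hε u) (h.integrable_multiplier hε v)]
  have e : (u - v) ⬝ᵥ (∫ s, (secondStageSol ε (γ s) (p s) u).2 -
        (secondStageSol ε (γ s) (p s) v).2 ∂Q) =
      ∫ s, (u - v) ⬝ᵥ ((secondStageSol ε (γ s) (p s) u).2 -
        (secondStageSol ε (γ s) (p s) v).2) ∂Q := by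
    simp only [dotProduct]
    rw [integral_finsetSum _ fun i _ => (hi.eval i).const_mul _]
    refine Finset.sum_congr rfl fun i _ => ?_
    rw [integral_const_mul]
    congr 1
    exact eval_integral (fun i => hi.eval i) i
  rw [e]
  exact integral_nonpos fun s => multiplier_sub_dotProduct_nonpos hε (h.γ_pos s) (p s) u v

lemma norm_expectedMultiplier_sub_le_of_param {ε₁ ε₂ : ℝ} (hε₁ : 0 < ε₁) (hε₂ : 0 < ε₂)
    {x : Fin J → ℝ} (hx : 0 ≤ x) :
    ‖expectedMultiplier Q γ p ε₁ x - expectedMultiplier Q γ p ε₂ x‖ ≤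
      J * (|ε₁ - ε₂| * p₀) / ε₁ := by
  rw [expectedMultiplier, expectedMultiplier,
    ← integral_sub (h.integrable_multiplier hε₁ x) (h.integrable_multiplier hε₂ x)]
  refine (norm_integral_le_of_norm_le_const (C := J * (|ε₁ - ε₂| * p₀) / ε₁)
    (.of_forall fun s => ?_)).trans_eq (by simp)
  rw [le_div_iff₀ hε₁, mul_comm]
  exact norm_multiplier_sub_le_of_param hε₁ hε₂ (h.γ_pos s) h.nonneg_p₀ (h.p_le s) hx

/-- The regularized first-stage problem is solvable. -/
lemma exists_regFirstStage {c : Fin J → ℝ} (hc : ∀ j, 0 < c j) (a : Fin J → ℝ) {ε : ℝ}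
    (hε : 0 < ε) :
    ∃ x, Complementary x ((Matrix.diagonal c).mulVec x - expectedMultiplier Q γ p ε x + a) := by
  obtain ⟨m, hm, hmc⟩ := exists_pos_forall_le hc
  exact exists_firstStage hm hmc (by positivity)
    (h.sub_dotProduct_expectedMultiplier_sub_nonpos Q hε) (h.norm_expectedMultiplier_sub_le Q hε)

/-- Solutions of the regularized first-stage problem depend Lipschitz continuously on the
regularization parameter, uniformly in the measure. -/
lemma norm_regFirstStage_sub_le {c a : Fin J → ℝ} {m : ℝ} (hm : 0 < m) (hmc : ∀ j, m ≤ c j)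
    {ε₁ ε₂ : ℝ} (hε₁ : 0 < ε₁) (hε₂ : 0 < ε₂) {x₁ x₂ : Fin J → ℝ}
    (h₁ : Complementary x₁ ((Matrix.diagonal c).mulVec x₁ - expectedMultiplier Q γ p ε₁ x₁ + a))
    (h₂ : Complementary x₂ ((Matrix.diagonal c).mulVec x₂ - expectedMultiplier Q γ p ε₂ x₂ + a)) :
    ‖x₁ - x₂‖ ≤ J * (J * (|ε₁ - ε₂| * p₀) / ε₁) / m := by
  rw [le_div_iff₀ hm, mul_comm]
  refine (firstStage_stability hmc hm.le (h.sub_dotProduct_expectedMultiplier_sub_nonpos Q hε₁)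
    h₁ h₂).trans ?_
  gcongr
  exact h.norm_expectedMultiplier_sub_le_of_param Q hε₁ hε₂ h₂.1

end IsBoundedData

end ExpectedMultiplier

/-! ### The SAA problem as the problem of the empirical measure -/

section Empirical

variable {J : ℕ} {Ξ : Type*} [MeasurableSpace Ξ]

/-- The empirical measure of finitely many sample points. -/
def empiricalMeasure {ν : ℕ} (s : Fin ν → Ξ) : Measure Ξ :=
  (ν : ENNReal)⁻¹ • ∑ l, Measure.dirac (s l)

lemma isProbabilityMeasure_empiricalMeasure {ν : ℕ} (hν : 1 ≤ ν) (s : Fin ν → Ξ) :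
    IsProbabilityMeasure (empiricalMeasure s) := by
  refine ⟨?_⟩
  have : (ν : ENNReal) ≠ 0 := by exact_mod_cast (by omega : ν ≠ 0)
  simp [empiricalMeasure, ENNReal.inv_mul_cancel this]

lemma integral_empiricalMeasure {E : Type*} [NormedAddCommGroup E] [NormedSpace ℝ E]
    [CompleteSpace E] {ν : ℕ} (s : Fin ν → Ξ) {f : Ξ → E} (hf : StronglyMeasurable f) :
    ∫ t, f t ∂(empiricalMeasure s) = (1 / (ν : ℝ)) • ∑ l, f (s l) := by
  rw [empiricalMeasure, integral_smul_measure, integral_finsetSum_measure]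
  · simp [integral_dirac' _ _ hf]
  · intro l _
    exact integrable_dirac' hf (by simp)

namespace IsBoundedData

variable {γ : Ξ → ℝ} {p : Ξ → Fin J → ℝ} {γ₀ p₀ : ℝ} (h : IsBoundedData γ p γ₀ p₀)
include h

lemma expectedMultiplier_empiricalMeasure {ν : ℕ} (s : Fin ν → Ξ) {ε : ℝ} (hε : 0 < ε)
    (x : Fin J → ℝ) : expectedMultiplier (empiricalMeasure s) γ p ε x =
      (1 / (ν : ℝ)) • ∑ l, (secondStageSol ε (γ (s l)) (p (s l)) x).2 :=
  integral_empiricalMeasure s (h.measurable_multiplier hε x).stronglyMeasurable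

/-- The regularized sample average approximation is the regularized first-stage problem of the
empirical measure. -/
lemma isSAASolution_iff {c a : Fin J → ℝ} {ν : ℕ} (s : Fin ν → Ξ) {ε : ℝ} (hε : 0 < ε)
    {x : Fin J → ℝ} {y lam : Fin ν → Fin J → ℝ} :
    IsSAASolution c a γ p ε ν s x y lam ↔
      Complementary x ((Matrix.diagonal c).mulVec x -
        expectedMultiplier (empiricalMeasure s) γ p ε x + a) ∧
      (y = fun l => (secondStageSol ε (γ (s l)) (p (s l)) x).1) ∧
      lam = fun l => (secondStageSol ε (γ (s l)) (p (s l)) x).2 := by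
  have hs := fun l => secondStage_secondStageSol hε (h.γ_pos (s l)) (p (s l)) x
  rw [h.expectedMultiplier_empiricalMeasure s hε]
  constructor
  · rintro ⟨h1, h2⟩
    have h3 := fun l =>
      (solvesLCP_regSecondStageMatrix_iff.1 (h2 l)).unique hε (h.γ_pos _) (hs l)
    have h4 : lam = fun l => (secondStageSol ε (γ (s l)) (p (s l)) x).2 :=
      funext fun l => (h3 l).2
    subst h4
    exact ⟨h1, funext fun l => (h3 l).1, rfl⟩
  · rintro ⟨h1, rfl, rfl⟩
    exact ⟨h1, fun l => solvesLCP_regSecondStageMatrix_iff.2 (hs l)⟩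

lemma existsUnique_isSAASolution {c : Fin J → ℝ} (hc : ∀ j, 0 < c j) (a : Fin J → ℝ) {ν : ℕ}
    (hν : 1 ≤ ν) (s : Fin ν → Ξ) {ε : ℝ} (hε : 0 < ε) :
    ∃! z : (Fin J → ℝ) × (Fin ν → Fin J → ℝ) × (Fin ν → Fin J → ℝ),
      IsSAASolution c a γ p ε ν s z.1 z.2.1 z.2.2 := by
  have := isProbabilityMeasure_empiricalMeasure hν s
  obtain ⟨x, hx⟩ := h.exists_regFirstStage (empiricalMeasure s) hc a hε
  refine ⟨(x, fun l => (secondStageSol ε (γ (s l)) (p (s l)) x).1,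
    fun l => (secondStageSol ε (γ (s l)) (p (s l)) x).2), (h.isSAASolution_iff s hε).2 ⟨hx, rfl, rfl⟩, ?_⟩
  rintro ⟨x', y', l'⟩ h'
  obtain ⟨hx', e1, e2⟩ := (h.isSAASolution_iff s hε).1 h'
  obtain ⟨m, hm, hmc⟩ := exists_pos_forall_le hc
  -- Uniqueness is the Lipschitz estimate in the regularization parameter with both parameters
  -- equal.
  have h0 := h.norm_regFirstStage_sub_le (empiricalMeasure s) hm hmc hε hε hx' hx
  simp only [sub_self, abs_zero, zero_mul, mul_zero, zero_div, norm_le_zero_iff,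
    sub_eq_zero] at h0
  dsimp only at h0 e1 e2
  subst h0 e1 e2
  rfl

end IsBoundedData

end Empirical

/-! ### Vanishing regularization; replacing data on null sets -/

section Limit

variable {J : ℕ} {Ξ : Type*} [MeasurableSpace Ξ] {γ : Ξ → ℝ} {p : Ξ → Fin J → ℝ} {γ₀ p₀ : ℝ}

/-- The second-stage decisions converge pointwise as the first-stage decisions converge and the
regularization parameter vanishes. -/
lemma IsBoundedData.exists_tendsto_decision (h : IsBoundedData γ p γ₀ p₀) {e : ℕ → ℝ}
    (he : ∀ k, 0 < e k) (he0 : Tendsto e atTop (𝓝 0)) {x : ℕ → Fin J → ℝ} {x₀ : Fin J → ℝ}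
    (hx : ∀ k, 0 ≤ x k) (hx0 : Tendsto x atTop (𝓝 x₀)) (s : Ξ) :
    ∃ y, Tendsto (fun k => (secondStageSol (e k) (γ s) (p s) (x k)).1) atTop (𝓝 y) := by
  refine cauchySeq_tendsto_of_complete (cauchySeq_iff_tendsto_dist_atTop_0.2 ?_)
  have h1 : Tendsto (fun n : ℕ × ℕ => |e n.1 - e n.2|) atTop (𝓝 0) := by
    simpa [Real.dist_eq] using cauchySeq_iff_tendsto_dist_atTop_0.1 he0.cauchySeq
  have h2 : Tendsto (fun n : ℕ × ℕ => ‖x n.1 - x n.2‖) atTop (𝓝 0) := by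
    simpa [dist_eq_norm] using cauchySeq_iff_tendsto_dist_atTop_0.1 hx0.cauchySeq
  have h3 : Tendsto (fun n : ℕ × ℕ =>
      √(J * (2 * p₀ * (|e n.1 - e n.2| * p₀ + ‖x n.1 - x n.2‖)) / γ₀)) atTop (𝓝 0) := by
    have h4 := (((((h1.mul_const p₀).add h2).const_mul (2 * p₀)).const_mul (J : ℝ)).div_const
      γ₀).sqrt
    simpa using h4
  refine squeeze_zero (fun _ => dist_nonneg) (fun n => Real.le_sqrt_of_sq_le ?_) h3
  rw [dist_eq_norm, le_div_iff₀ h.pos_γ₀, mul_comm]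
  exact norm_decision_sub_sq_le (he _) (he _) h.pos_γ₀ (h.le_γ s) h.nonneg_p₀ (h.p_le s) (hx _)
    (hx _)

/-- Limits of regularized first-stage solutions, as the regularization parameter vanishes, are
first-stage solutions of the original problem. -/
theorem IsBoundedData.mem_firstStageSolutions_of_tendsto (h : IsBoundedData γ p γ₀ p₀)
    (P : Measure Ξ) [IsProbabilityMeasure P] {c a : Fin J → ℝ} {e : ℕ → ℝ} (he : ∀ k, 0 < e k)
    (he0 : Tendsto e atTop (𝓝 0)) {x : ℕ → Fin J → ℝ} {x₀ : Fin J → ℝ}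
    (hsol : ∀ k, Complementary (x k)
      ((Matrix.diagonal c).mulVec (x k) - expectedMultiplier P γ p (e k) (x k) + a))
    (hx0 : Tendsto x atTop (𝓝 x₀)) : x₀ ∈ firstStageSolutions P c a γ p := by
  have hx : ∀ k, 0 ≤ x k := fun k => (hsol k).1
  choose y hy using h.exists_tendsto_decision he he0 hx hx0
  set z : ℕ → Ξ → (Fin J → ℝ) × (Fin J → ℝ) := fun k s =>
    secondStageSol (e k) (γ s) (p s) (x k) with hz
  have hS : ∀ k s, SecondStage (e k) (γ s) (p s) (x k) (z k s).1 (z k s).2 := fun k s =>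
    secondStage_secondStageSol (he k) (h.γ_pos s) (p s) (x k)
  -- The limit multiplier is defined by the `ε`-free formula at the limit decision, since the
  -- stability estimates for λ degenerate as `ε` vanishes.
  set lam : Ξ → Fin J → ℝ := fun s j => max (p s j - (supplyMatrix J (γ s)).mulVec (y s) j) 0
  have hmul : ∀ s, Tendsto (fun k => (supplyMatrix J (γ s)).mulVec (z k s).1) atTop
      (𝓝 ((supplyMatrix J (γ s)).mulVec (y s))) := fun s =>
    ((Matrix.mulVecLin (supplyMatrix J (γ s))).continuous_of_finiteDimensional.tendsto
      (y s)).comp (hy s)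
  have hl : ∀ s, Tendsto (fun k => (z k s).2) atTop (𝓝 (lam s)) := by
    intro s
    refine tendsto_pi_nhds.2 fun j => ?_
    have e1 : (fun k => (z k s).2 j) = fun k =>
        max (p s j - (supplyMatrix J (γ s)).mulVec (z k s).1 j) 0 :=
      funext fun k => (hS k s).multiplier_eq (he k) (hx k) j
    rw [e1]
    exact (tendsto_const_nhds.sub (tendsto_pi_nhds.1 (hmul s) j)).max tendsto_const_nhds
  have hlk : ∀ k s, ‖(z k s).2‖ ≤ p₀ := fun k => h.norm_multiplier_le (he k) (hx k)
  have hyk : ∀ k s, ‖(z k s).1‖ ≤ p₀ / γ₀ := fun k s =>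
    (hS k s).norm_decision_le h.pos_γ₀ (h.le_γ s) h.nonneg_p₀ (h.p_le s)
  have hzm : ∀ k, Measurable (z k) := fun k => h.measurable_secondStageSol (he k) (x k)
  have hym : Measurable y :=
    measurable_of_tendsto_metrizable (fun k => (hzm k).fst) (tendsto_pi_nhds.2 hy)
  have hlm : Measurable lam :=
    measurable_of_tendsto_metrizable (fun k => (hzm k).snd) (tendsto_pi_nhds.2 hl)
  have hE : Tendsto (fun k => expectedMultiplier P γ p (e k) (x k)) atTop (𝓝 (∫ s, lam s ∂P)) :=
    tendsto_integral_of_dominated_convergence (fun _ => p₀)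
      (fun k => (hzm k).snd.aestronglyMeasurable) (integrable_const _)
      (fun k => .of_forall (hlk k)) (.of_forall hl)
  refine ⟨y, lam, ?_, ?_, ?_, .of_forall fun s => ?_⟩
  · exact memLp_top_of_bound hym.aestronglyMeasurable (p₀ / γ₀)
      (.of_forall fun s => le_of_tendsto' (hy s).norm fun k => hyk k s)
  · exact MemLp.of_bound hlm.aestronglyMeasurable p₀
      (.of_forall fun s => le_of_tendsto' (hl s).norm fun k => hlk k s)
  · refine Complementary.of_tendsto hsol hx0 ?_
    exact (((Matrix.mulVecLin (Matrix.diagonal c)).continuous_of_finiteDimensional.tendsto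
      x₀).comp hx0 |>.sub hE).add_const a
  · rw [secondStageMatrix_eq, solvesLCP_regSecondStageMatrix_iff]
    refine ⟨Complementary.of_tendsto (fun k => (hS k s).1) (hy s)
        (((hmul s).add (hl s)).sub_const _),
      Complementary.of_tendsto (fun k => (hS k s).2) (hl s) ?_⟩
    -- The regularizing term ελ tends to 0 because λ converges; this leaves the system with
    -- parameter 0.
    exact ((he0.smul (hl s)).sub (hy s)).add hx0

/-- The truncated data that satisfy everywhere the bounds which the given data satisfy almost
everywhere. -/
lemma isBoundedData_truncation (hγm : Measurable γ) (hpm : Measurable p) (hγ₀ : 0 < γ₀)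
    (hp₀ : 0 ≤ p₀) :
    IsBoundedData (fun s => max (γ s) γ₀) (fun s j => min (p s j) p₀) γ₀ p₀ where
  measurable_γ := hγm.max measurable_const
  measurable_p := measurable_pi_lambda _ fun j => ((measurable_pi_apply j).comp hpm).min
    measurable_const
  pos_γ₀ := hγ₀
  nonneg_p₀ := hp₀
  le_γ _ := le_max_right _ _
  p_le _ _ := min_le_right _ _

lemma firstStageSolutions_congr {P : Measure Ξ} {c a : Fin J → ℝ} {γ' : Ξ → ℝ}
    {p' : Ξ → Fin J → ℝ} (h : ∀ᵐ s ∂P, γ' s = γ s ∧ p' s = p s) :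
    firstStageSolutions P c a γ' p' = firstStageSolutions P c a γ p := by
  have key : ∀ (x : Fin J → ℝ) (y lam : Ξ → Fin J → ℝ),
      (∀ᵐ s ∂P, SolvesLCP (Sum.elim (-p' s) x) (secondStageMatrix J (γ' s))
        (Sum.elim (y s) (lam s))) ↔
      ∀ᵐ s ∂P, SolvesLCP (Sum.elim (-p s) x) (secondStageMatrix J (γ s))
        (Sum.elim (y s) (lam s)) := fun x y lam =>
    eventually_congr (h.mono fun s hs => by rw [hs.1, hs.2])
  ext x
  constructor
  · rintro ⟨y, lam, h1, h2, h3, h4⟩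
    exact ⟨y, lam, h1, h2, h3, (key x y lam).1 h4⟩
  · rintro ⟨y, lam, h1, h2, h3, h4⟩
    exact ⟨y, lam, h1, h2, h3, (key x y lam).2 h4⟩

lemma isSAASolution_congr {S : Type*} {c a : Fin J → ℝ} {γ γ' : S → ℝ}
    {p p' : S → Fin J → ℝ} {ε : ℝ} {ν : ℕ} {s : Fin ν → S} (h : ∀ l, γ' (s l) = γ (s l) ∧ p' (s l) = p (s l)) {x : Fin J → ℝ}
    {y lam : Fin ν → Fin J → ℝ} :
    IsSAASolution c a γ p ε ν s x y lam ↔ IsSAASolution c a γ' p' ε ν s x y lam := by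
  constructor
  · rintro ⟨h1, h2⟩
    exact ⟨h1, fun l => by rw [(h l).1, (h l).2]; exact h2 l⟩
  · rintro ⟨h1, h2⟩
    exact ⟨h1, fun l => by rw [← (h l).1, ← (h l).2]; exact h2 l⟩

end Limit

/-! ### Law of large numbers and convergence of SAA solutions -/

section Sampling

variable {J : ℕ} {Ξ : Type*} [MeasurableSpace Ξ] {γ : Ξ → ℝ} {p : Ξ → Fin J → ℝ} {γ₀ p₀ : ℝ}
  {Ω : Type*} [MeasurableSpace Ω]

/-- The strong law of large numbers for integrals against empirical measures. -/
lemma ae_tendsto_integral_empiricalMeasure {E : Type*} [NormedAddCommGroup E] [NormedSpace ℝ E]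
    [CompleteSpace E] [MeasurableSpace E] [BorelSpace E] {P : Measure Ξ} {μ : Measure Ω}
    {ξ : ℕ → Ω → Ξ} (hξm : ∀ l, Measurable (ξ l)) (hξlaw : ∀ l, μ.map (ξ l) = P)
    (hξindep : iIndepFun ξ μ) {f : Ξ → E} (hf : StronglyMeasurable f) (hfi : Integrable f P) :
    ∀ᵐ ω ∂μ, Tendsto (fun ν : ℕ => ∫ t, f t ∂(empiricalMeasure fun l : Fin ν => ξ l ω)) atTop
      (𝓝 (∫ t, f t ∂P)) := by
  have hi : Integrable (f ∘ ξ 0) μ :=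
    (integrable_map_measure (by rw [hξlaw]; exact hf.aestronglyMeasurable)
      (hξm 0).aemeasurable).1 (by rwa [hξlaw])
  have hident : ∀ i, IdentDistrib (f ∘ ξ i) (f ∘ ξ 0) μ μ := fun i =>
    (IdentDistrib.mk (hξm i).aemeasurable (hξm 0).aemeasurable
      (by rw [hξlaw, hξlaw])).comp hf.measurable
  have hindep : Pairwise (Function.onFun (· ⟂ᵢ[μ] ·) fun i => f ∘ ξ i) := fun i j hij =>
    (hξindep.indepFun hij).comp hf.measurable hf.measurable
  filter_upwards [strong_law_ae (fun i => f ∘ ξ i) hi hindep hident] with ω hω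
  have e : μ[f ∘ ξ 0] = ∫ t, f t ∂P := by
    rw [← hξlaw 0, integral_map (hξm 0).aemeasurable hf.aestronglyMeasurable]
    rfl
  rw [e] at hω
  refine hω.congr fun ν => ?_
  rw [integral_empiricalMeasure _ hf, Finset.sum_range, one_div]
  rfl

/-- Almost surely, regularized first-stage solutions for the empirical measures converge to
the one for the true measure, simultaneously for all regularization parameters. -/
theorem IsBoundedData.ae_tendsto_regFirstStage (h : IsBoundedData γ p γ₀ p₀) {P : Measure Ξ}
    [IsProbabilityMeasure P] {c a : Fin J → ℝ} (hc : ∀ j, 0 < c j) {μ : Measure Ω}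
    {ξ : ℕ → Ω → Ξ} (hξm : ∀ l, Measurable (ξ l)) (hξlaw : ∀ l, μ.map (ξ l) = P)
    (hξindep : iIndepFun ξ μ) {x : ℝ → Fin J → ℝ}
    (hx : ∀ ε, 0 < ε → Complementary (x ε)
      ((Matrix.diagonal c).mulVec (x ε) - expectedMultiplier P γ p ε (x ε) + a)) :
    ∀ᵐ ω ∂μ, ∀ X : ℝ → ℕ → Fin J → ℝ,
      (∀ ε, 0 < ε → ∀ ν : ℕ, 1 ≤ ν → Complementary (X ε ν) ((Matrix.diagonal c).mulVec (X ε ν) -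
        expectedMultiplier (empiricalMeasure fun l : Fin ν => ξ l ω) γ p ε (X ε ν) + a)) →
      ∀ ε, 0 < ε → Tendsto (X ε) atTop (𝓝 (x ε)) := by
  obtain ⟨m, hm, hmc⟩ := exists_pos_forall_le hc
  -- Countably many applications of the strong law, each at the single deterministic point `x q`,
  -- give a null set independent of `ε` and of `X`.
  have hlaw : ∀ᵐ ω ∂μ, ∀ q : ℚ, 0 < (q : ℝ) → Tendsto (fun ν : ℕ =>
      expectedMultiplier (empiricalMeasure fun l : Fin ν => ξ l ω) γ p q (x q)) atTop
      (𝓝 (expectedMultiplier P γ p q (x q))) := by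
    refine ae_all_iff.2 fun q => ?_
    by_cases hq : 0 < (q : ℝ)
    · filter_upwards [ae_tendsto_integral_empiricalMeasure hξm hξlaw hξindep
        (h.measurable_multiplier hq (x q)).stronglyMeasurable
        (h.integrable_multiplier hq (x q))] with ω hω _ using hω
    · exact .of_forall fun _ h' => (hq h').elim
  filter_upwards [hlaw] with ω hω X hX ε hε
  have hrat : ∀ q : ℚ, 0 < (q : ℝ) → Tendsto (X q) atTop (𝓝 (x q)) := by
    intro q hq
    refine tendsto_iff_norm_sub_tendsto_zero.2 ?_
    have h0 := (((tendsto_iff_norm_sub_tendsto_zero.1 (hω q hq)).const_mul (J : ℝ)).div_const m)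
    rw [mul_zero, zero_div] at h0
    refine squeeze_zero' (.of_forall fun _ => norm_nonneg _) ?_ h0
    filter_upwards [eventually_ge_atTop 1] with ν hν
    have := isProbabilityMeasure_empiricalMeasure hν fun l : Fin ν => ξ l ω
    rw [le_div_iff₀ hm, mul_comm]
    exact firstStage_stability hmc hm.le
      (h.sub_dotProduct_expectedMultiplier_sub_nonpos _ hq) (hX q hq ν hν) (hx q hq)
  -- This bound on the distance between solutions for `ε` and `t` is the same for P and for all
  -- empirical measures with ν ≥ 1, so one rational `q` near `ε` serves every such ν.
  have hlip : Tendsto (fun t : ℝ => J * (J * (|ε - t| * p₀) / ε) / m) (𝓝 ε) (𝓝 0) := by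
    have : Continuous fun t : ℝ => J * (J * (|ε - t| * p₀) / ε) / m := by fun_prop
    simpa using this.tendsto ε
  rw [Metric.tendsto_atTop]
  intro δ hδ
  obtain ⟨r, hr, hball⟩ := Metric.eventually_nhds_iff.1
    ((hlip.eventually_lt_const (by positivity : (0 : ℝ) < δ / 3)).and (lt_mem_nhds hε))
  obtain ⟨q, hq1, hq2⟩ := exists_rat_btwn (lt_add_of_pos_right ε hr)
  obtain ⟨hb, hq⟩ := hball (y := (q : ℝ)) (by rw [Real.dist_eq, abs_lt]; constructor <;> linarith)
  obtain ⟨N, hN⟩ := Metric.tendsto_atTop.1 (hrat q hq) (δ / 3) (by positivity)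
  refine ⟨max N 1, fun ν hν => ?_⟩
  have hν1 : 1 ≤ ν := (le_max_right _ _).trans hν
  have := isProbabilityMeasure_empiricalMeasure hν1 fun l : Fin ν => ξ l ω
  have d1 := h.norm_regFirstStage_sub_le _ hm hmc hε hq (hX ε hε ν hν1) (hX q hq ν hν1)
  have d2 := hN ν ((le_max_left _ _).trans hν)
  have d3 := h.norm_regFirstStage_sub_le _ hm hmc hε hq (hx ε hε) (hx q hq)
  rw [← dist_eq_norm] at d1 d3
  rw [dist_comm] at d3
  linarith [dist_triangle4 (X ε ν) (X q ν) (x q) (x ε)]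

end Sampling

end TwoStageSCP

end

/-! ### Reduction to data bounded everywhere, and conclusion -/

theorem theorem4p5 {J : ℕ}
    {Ξ : Type*} [MeasurableSpace Ξ] (P : Measure Ξ) [IsProbabilityMeasure P]
    (c a : Fin J → ℝ) (hc : ∀ j, 0 < c j) (ha : ∀ j, 0 < a j)
    (γ : Ξ → ℝ) (hγm : Measurable γ) (p : Ξ → Fin J → ℝ) (hpm : Measurable p)
    (γ₀ : ℝ) (hγ₀ : 0 < γ₀) (hγ : ∀ᵐ s ∂P, γ₀ ≤ γ s)
    (p₀ : ℝ) (hp₀ : 0 < p₀) (hp : ∀ j, ∀ᵐ s ∂P, p s j ≤ p₀)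
    {Ω : Type*} [MeasurableSpace Ω] (μ : Measure Ω) [IsProbabilityMeasure μ]
    (ξ : ℕ → Ω → Ξ) (hξm : ∀ l, Measurable (ξ l)) (hξlaw : ∀ l, μ.map (ξ l) = P)
    (hξindep : iIndepFun ξ μ) :
    ∀ᵐ ω ∂μ,
      -- the regularized sample average problem has exactly one solution
      (∀ ε : ℝ, 0 < ε → ∀ ν : ℕ, 1 ≤ ν →
        ∃! z : (Fin J → ℝ) × (Fin ν → Fin J → ℝ) × (Fin ν → Fin J → ℝ),
          TwoStageSCP.IsSAASolution c a γ p ε ν (fun l => ξ l ω) z.1 z.2.1 z.2.2) ∧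
      -- if `X ε ν` is its first-stage part, the limits as `ν → ∞` exist, and their outer limit
      -- as `ε ↓ 0` consists of first-stage solutions of the original problem
      ∀ X : ℝ → ℕ → Fin J → ℝ,
        (∀ ε : ℝ, 0 < ε → ∀ ν : ℕ, 1 ≤ ν → ∃ y lam : Fin ν → Fin J → ℝ,
          TwoStageSCP.IsSAASolution c a γ p ε ν (fun l => ξ l ω) (X ε ν) y lam) →
        ∃ xlim : ℝ → Fin J → ℝ,
          (∀ ε : ℝ, 0 < ε → Tendsto (fun ν => X ε ν) atTop (𝓝 (xlim ε))) ∧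
          TwoStageSCP.outerLimit xlim ⊆ TwoStageSCP.firstStageSolutions P c a γ p := by
  have hb := TwoStageSCP.isBoundedData_truncation hγm hpm hγ₀ hp₀.le
  have hP : ∀ᵐ s ∂P, max (γ s) γ₀ = γ s ∧ (fun j => min (p s j) p₀) = p s := by
    filter_upwards [hγ, ae_all_iff.2 hp] with s h1 h2
    exact ⟨max_eq_left h1, funext fun j => min_eq_left (h2 j)⟩
  -- Almost surely no sample point meets the null set where truncation changes the data, so the SAA
  -- problems are unchanged.
  have hsample : ∀ᵐ ω ∂μ, ∀ l, max (γ (ξ l ω)) γ₀ = γ (ξ l ω) ∧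
      (fun j => min (p (ξ l ω) j) p₀) = p (ξ l ω) :=
    ae_all_iff.2 fun l => ae_of_ae_map (hξm l).aemeasurable (by rwa [hξlaw l])
  -- Positivity of `ε` sits inside the existential so that choice gives a total function; its values
  -- at `ε ≤ 0` never enter the outer limit.
  have hex : ∀ ε : ℝ, ∃ x, 0 < ε → TwoStageSCP.Complementary x ((Matrix.diagonal c).mulVec x -
      TwoStageSCP.expectedMultiplier P (fun s => max (γ s) γ₀) (fun s j => min (p s j) p₀) ε x +
        a) := by
    intro ε
    by_cases hε : 0 < ε
    · obtain ⟨x, hx⟩ := hb.exists_regFirstStage P hc a hε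
      exact ⟨x, fun _ => hx⟩
    · exact ⟨0, fun h => (hε h).elim⟩
  choose xlim hxlim using hex
  filter_upwards [hsample, hb.ae_tendsto_regFirstStage hc hξm hξlaw hξindep hxlim] with ω hω hlim
  have hsaa : ∀ ε ν x (y lam : Fin ν → Fin J → ℝ),
      TwoStageSCP.IsSAASolution c a γ p ε ν (fun l => ξ l ω) x y lam ↔
        TwoStageSCP.IsSAASolution c a (fun s => max (γ s) γ₀) (fun s j => min (p s j) p₀) ε ν
          (fun l => ξ l ω) x y lam := fun _ _ _ _ _ =>
    TwoStageSCP.isSAASolution_congr fun l => hω l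
  refine ⟨fun ε hε ν hν => ?_, fun X hX => ⟨xlim, hlim X fun ε hε ν hν => ?_, ?_⟩⟩
  · simp only [hsaa]
    exact hb.existsUnique_isSAASolution hc a hν _ hε
  · obtain ⟨y, lam, h⟩ := hX ε hε ν hν
    exact ((hb.isSAASolution_iff _ hε).1 ((hsaa ..).1 h)).1
  · rintro x₀ ⟨e, he, he0, hx0⟩
    rw [← TwoStageSCP.firstStageSolutions_congr hP]
    exact hb.mem_firstStageSolutions_of_tendsto P he he0 (fun k => hxlim _ (he k)) hx0
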